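/- Let $H$ be a finite abelian group, let $K$ be a transitive permutation group on a nonempty finite set $\Omega$, and let $H\wr K=H^{\Omega}\rtimes K$ be the permutational wreath product, where $K$ permutes the coordinates of $H^\Omega$. For a finite group $G$ let $d(G)$ be its minimal number of generators, and for a prime $p$ let $d_p(H)$ be the minimal number of generators of the Sylow $p$-subgroup of $H$. For a nontrivial irreducible $\mathbb F_pK$-module $M$ (one on which $K$ does not act trivially) put $$r_K(M)=\dim_{\operatorname{End}_K(M)}M,\qquad s_K(M)=\dim_{\operatorname{End}_K(M)}H^1(K,M),\qquad h_K(M)=\left\lfloor\frac{s_K(M)-1}{r_K(M)}\right\rfloor+2 .$$ Let $\rho_{K,H,p}=\max_M h_K(M)+d_p(H)$, where $M$ ranges over the nontrivial irreducible $\mathbb F_pK$-modules, and $\rho_{K,H,p}=0$ if every irreducible $\mathbb F_pK$-module is trivial. Then $$d(H\wr K)\le\max\Big(d(H\times K),\ \max_{p\mid |H|}\rho_{K,H,p}\Big),$$ where $p$ ranges over the prime divisors of $|H|$ and the inner maximum is taken to be $0$ if $H$ is trivial. -/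

import Mathlib

/-- The permutational wreath product `H ≀ K` of a group `H` with a group `K` of permutations
of `Ω`: the semidirect product of the base group `Ω → H` by `K`, where `k : K` sends
`f : Ω → H` to `fun x ↦ f (k⁻¹ • x)`. -/
abbrev PermWreath {Ω : Type*} (H : Type*) [Group H] (K : Subgroup (Equiv.Perm Ω)) : Type _ :=
  (Ω → H) ⋊[mulAutArrow] K

instance PermWreath.instFinite {Ω : Type*} [Finite Ω] (H : Type*) [Group H] [Finite H]
    (K : Subgroup (Equiv.Perm Ω)) : Finite (PermWreath H K) :=
  Finite.of_equiv _ SemidirectProduct.equivProd.symm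

/-- `d_p(A)`: the minimal number of generators of the Sylow `p`-subgroup of a finite abelian
group `A`. -/
noncomputable def sylowRank (p : ℕ) (A : Type*) [CommGroup A] [Finite A] : ℕ :=
  Group.rank ((default : Sylow p A) : Subgroup A)

section GroupModules

variable (p : ℕ) (G : Type*) [Group G]
variable (M : Type*) [AddCommGroup M] [Module (MonoidAlgebra (ZMod p) G) M]

/-- `End_G(M)` for an `𝔽_p G`-module `M`. -/
abbrev EndG : Type _ := Module.End (MonoidAlgebra (ZMod p) G) M

/-- `G` acts trivially on the `𝔽_p G`-module `M`. -/
def IsTrivialModule : Prop :=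
  ∀ (g : G) (m : M), MonoidAlgebra.of (ZMod p) G g • m = m

/-- The 1-cocycles (crossed homomorphisms) `G → M`; `End_G(M)` acts by composition. -/
def oneCocycles : Submodule (EndG p G M) (G → M) where
  carrier := {f | ∀ g h : G, f (g * h) = MonoidAlgebra.of (ZMod p) G g • f h + f g}
  zero_mem' := fun g h => by simp
  add_mem' := fun {a b} ha hb g h => by
    simp only [Set.mem_ofPred_eq] at ha hb
    simp only [Pi.add_apply, ha, hb, smul_add]
    abel
  smul_mem' := fun c f hf g h => by
    simp only [Set.mem_ofPred_eq] at hf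
    simp only [Pi.smul_apply, Module.End.smul_def, hf, map_add, map_smul]

/-- The 1-coboundaries `g ↦ g m - m`, for `m : M`. -/
def oneCoboundaries : Submodule (EndG p G M) (G → M) where
  carrier := {f | ∃ m : M, ∀ g : G, f g = MonoidAlgebra.of (ZMod p) G g • m - m}
  zero_mem' := ⟨0, fun g => by simp⟩
  add_mem' := by
    rintro a b ⟨m, hm⟩ ⟨m', hm'⟩
    refine ⟨m + m', fun g => ?_⟩
    simp only [Pi.add_apply, hm, hm', smul_add]
    abel
  smul_mem' := by
    rintro c f ⟨m, hm⟩
    refine ⟨c • m, fun g => ?_⟩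
    simp only [Pi.smul_apply, Module.End.smul_def, hm, map_sub, map_smul]

theorem oneCoboundaries_le_oneCocycles : oneCoboundaries p G M ≤ oneCocycles p G M := by
  rintro f ⟨m, hm⟩ g h
  simp only [hm, map_mul, mul_smul, smul_sub]
  abel

/-- The first cohomology group `H¹(G, M)`, as a module over `End_G(M)`. -/
abbrev FirstCohomology : Type _ :=
  oneCocycles p G M ⧸ (oneCoboundaries p G M).submoduleOf (oneCocycles p G M)

/-- `r_G(M) = dim_{End_G(M)} M`. -/
noncomputable def rInv : ℕ := Module.finrank (EndG p G M) M

/-- `s_G(M) = dim_{End_G(M)} H¹(G, M)`. -/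
noncomputable def sInv : ℕ := Module.finrank (EndG p G M) (FirstCohomology p G M)

/-- `h_G(M) = ⌊(s_G(M) - 1) / r_G(M)⌋ + 2`, for a nontrivial irreducible `𝔽_p G`-module `M`.
The division in `ℤ` rounds down, as `r_G(M) > 0`, and the value is at least `1`, so that
`Int.toNat` does not alter it. -/
noncomputable def hInv : ℕ := (((sInv p G M : ℤ) - 1) / (rInv p G M : ℤ) + 2).toNat

end GroupModules

/-- The set of the numbers `h_G(M)`, for the nontrivial irreducible `𝔽_p G`-modules `M`. -/
def hValues.{u} (p : ℕ) (G : Type u) [Group G] : Set ℕ :=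
  {x | ∃ (M : Type u) (_ : AddCommGroup M) (_ : Module (MonoidAlgebra (ZMod p) G) M),
    IsSimpleModule (MonoidAlgebra (ZMod p) G) M ∧ ¬ IsTrivialModule p G M ∧ x = hInv p G M}

/-- For a finite group the numbers `h_G(M)` are bounded, so that their supremum is a maximum. -/
theorem bddAbove_hValues.{u} (p : ℕ) [Fact p.Prime] (G : Type u) [Group G] [Finite G] :
    BddAbove (hValues p G) := by
  classical
  have hRfin : Finite (MonoidAlgebra (ZMod p) G) :=
    Module.finite_of_finite (ZMod p)
  refine ⟨Nat.card (MonoidAlgebra (ZMod p) G) ^ Nat.card G + 2, ?_⟩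
  rintro x ⟨M, _, _, hM, -, rfl⟩
  have hnt : Nontrivial M := IsSimpleModule.nontrivial (MonoidAlgebra (ZMod p) G) M
  obtain ⟨m, hm⟩ := exists_ne (0 : M)
  have hsurj : Function.Surjective (LinearMap.toSpanSingleton (MonoidAlgebra (ZMod p) G) M m) :=
    IsSimpleModule.toSpanSingleton_surjective _ hm
  have hMfin : Finite M := Finite.of_surjective _ hsurj
  have hMcard : Nat.card M ≤ Nat.card (MonoidAlgebra (ZMod p) G) :=
    Nat.card_le_card_of_surjective _ hsurj
  have hs : sInv p G M ≤ Nat.card (MonoidAlgebra (ZMod p) G) ^ Nat.card G := by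
    have hq : Finite (FirstCohomology p G M) :=
      Finite.of_surjective _ (Submodule.mkQ_surjective
        ((oneCoboundaries p G M).submoduleOf (oneCocycles p G M)))
    have h1 : sInv p G M ≤ Nat.card (FirstCohomology p G M) := by
      unfold sInv Module.finrank Nat.card
      exact Cardinal.toNat_le_toNat (rank_le_card _ _) (Cardinal.lt_aleph0_of_finite _)
    have h2 : Nat.card (FirstCohomology p G M) ≤ Nat.card (oneCocycles p G M) :=
      Nat.card_le_card_of_surjective _ (Submodule.mkQ_surjective _)
    have h3 : Nat.card (oneCocycles p G M) ≤ Nat.card (G → M) :=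
      Nat.card_le_card_of_injective _ Subtype.val_injective
    rw [Nat.card_fun] at h3
    exact (h1.trans (h2.trans h3)).trans (Nat.pow_le_pow_left hMcard _)
  have hh : hInv p G M ≤ sInv p G M + 2 := by
    unfold hInv
    rcases Nat.eq_zero_or_pos (sInv p G M) with h0 | h0
    · rw [h0]
      have : ((0 : ℕ) - 1 : ℤ) / (rInv p G M : ℤ) ≤ 0 :=
        by
        rcases Nat.eq_zero_or_pos (rInv p G M) with hr | hr
        · simp [hr]
        · exact (Int.ediv_neg_of_neg_of_pos (by norm_num) (by exact_mod_cast hr)).le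
      omega
    · have : ((sInv p G M : ℤ) - 1) / (rInv p G M : ℤ) ≤ (sInv p G M : ℤ) - 1 :=
        Int.ediv_le_self _ (by omega)
      omega
  omega

/-- `ρ_{K,H,p} = max_M h_K(M) + d_p(H)`, with `M` ranging over the nontrivial irreducible
`𝔽_p K`-modules, and `ρ_{K,H,p} = 0` if there is no such `M` (`sSup ∅ = 0` in `ℕ`). -/
noncomputable def rho (K : Type*) [Group K] (H : Type*) [CommGroup H] [Finite H] (p : ℕ) : ℕ :=
  sSup ((fun x => x + sylowRank p H) '' hValues p K)

/-! Write `N = H^Ω`, let `V` be `N` as a `ℤK`-module, and let `I` be the augmentation ideal. If the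
`k i` generate `K` and the pairs `(x i, k i - 1)` span `V × I`, then the elements `x i k i` generate
`N ⋊ K` (`closure_range_eq_top_of_span`). So generating `k i`, padded to length `d`, only need
suitable `V`-coordinates.

These are found by a Gaschütz-type count (`exists_lift_span`): descending through the finite module
`V`, a step with simple factor `M` can fail only if `|Hom(V × I, M)| > |M|^d`. As a copy of `H`
generates `V`, this Hom embeds in `Hom(H, M) × Z¹(K, M)`. For trivial `M` the latter is `Hom(H × K,
M)`, of order at most `|M|^d(H × K)`. Otherwise `M` is an `𝔽_p K`-module with `p ∣ |H|`, where
`|Hom(H, M)| ≤ |M|^d_p(H)` and `|Z¹(K, M)| ≤ |M| |H¹(K, M)| ≤ |M|^h_K(M)`. -/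

/-! ### Lifting spanning families along a finite submodule. -/

theorem LinearMap.exists_extend_of_sup_eq_top {R P M : Type*} [Ring R] [AddCommGroup P]
    [Module R P] [AddCommGroup M] [Module R M] {S B : Submodule R P} (h : S ⊔ B = ⊤)
    (π : B →ₗ[R] M) (hπ : ∀ b : B, (b : P) ∈ S → π b = 0) :
    ∃ f : P →ₗ[R] M, (∀ x ∈ S, f x = 0) ∧ ∀ b : B, f b = π b := by
  let f₁ : P →ₗ.[R] M := ⟨S, 0⟩
  let f₂ : P →ₗ.[R] M := ⟨B, π⟩
  have H : ∀ (x : f₁.domain) (y : f₂.domain), (x : P) = y → f₁ x = f₂ y := fun x y hxy =>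
    (hπ y (hxy ▸ x.2)).symm
  have hd : ∀ x, x ∈ (f₁.sup f₂ H).domain := fun x => by
    change x ∈ S ⊔ B
    rw [h]
    trivial
  refine ⟨(f₁.sup f₂ H).toFun.comp (LinearMap.id.codRestrict _ hd), fun x hx => ?_, fun b => ?_⟩
  · have := LinearPMap.sup_apply H ⟨x, hx⟩ 0 ⟨x, hd x⟩ (by simp)
    exact this.trans (by simp [f₁])
  · have := LinearPMap.sup_apply H 0 b ⟨b, hd b⟩ (by simp)
    exact this.trans (by simp [f₂])

/-- The lifting step over a simple factor `B / ker π`: if no lift of `y` spans modulo `ker π`,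
then there are more homomorphisms to the simple module than families of its elements. -/
theorem exists_lift_span_sup_ker {R P M ι : Type*} [Ring R] [AddCommGroup P] [Module R P]
    [AddCommGroup M] [Module R M] [IsSimpleModule R M] [Finite M] [Finite ι]
    (B : Submodule R P) (π : B →ₗ[R] M) (hπ : Function.Surjective π)
    (y : ι → P) (hy : Submodule.span R (Set.range y) ⊔ B = ⊤)
    (h : ∀ f : P →ₗ[R] M, (∃ b ∈ B, f b ≠ 0) →
      Finite (P →ₗ[R] M) ∧ Nat.card (P →ₗ[R] M) ≤ Nat.card M ^ Nat.card ι) :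
    ∃ z : ι → P, (∀ i, z i - y i ∈ B) ∧
      Submodule.span R (Set.range z) ⊔ (LinearMap.ker π).map B.subtype = ⊤ := by
  by_contra! hcon
  choose σ hσ using hπ
  let z : (ι → M) → ι → P := fun c i => y i + σ (c i)
  have hz : ∀ c i, z c i - y i ∈ B := fun c i => by simp [z]
  have hker : IsCoatom (LinearMap.ker π) :=
    LinearMap.isCoatom_ker_of_surjective fun m => ⟨σ m, hσ m⟩
  have hspan : ∀ c, Submodule.span R (Set.range (z c)) ⊔ B = ⊤ := fun c => by
    rw [eq_top_iff, ← hy, sup_le_iff]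
    refine ⟨Submodule.span_le.2 ?_, le_sup_right⟩
    rintro _ ⟨i, rfl⟩
    have : y i = z c i - (z c i - y i) := by abel
    rw [this]
    exact sub_mem (Submodule.mem_sup_left (Submodule.subset_span ⟨i, rfl⟩))
      (Submodule.mem_sup_right (hz c i))
  -- As `ker π` is maximal in `B` and `z c` fails to span modulo it, the span of `z c` meets `B`
  -- inside `ker π`; hence `π` extends by zero on that span.
  have hex : ∀ c, ∃ f : P →ₗ[R] M, (∀ i, f (z c i) = 0) ∧ ∀ b : B, f b = π b := fun c => by
    set S := Submodule.span R (Set.range (z c)) with hS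
    have hle : LinearMap.ker π ≤ (S ⊔ (LinearMap.ker π).map B.subtype).comap B.subtype :=
      Submodule.map_le_iff_le_comap.1 le_sup_right
    have hne : (S ⊔ (LinearMap.ker π).map B.subtype).comap B.subtype ≠ ⊤ := fun htop => by
      refine hcon _ (hz c) (eq_top_iff.2 ?_)
      rw [← hspan c, sup_le_iff]
      refine ⟨le_sup_left, fun b hb => ?_⟩
      exact (htop.ge (Submodule.mem_top (x := (⟨b, hb⟩ : B))) :)
    have heq := hker.le_iff_eq hne |>.1 hle
    obtain ⟨f, hf, hfb⟩ := LinearMap.exists_extend_of_sup_eq_top (hspan c) π fun b hb => by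
      have : b ∈ LinearMap.ker π := heq ▸ Submodule.mem_sup_left hb
      exact this
    exact ⟨f, fun i => hf _ (Submodule.subset_span ⟨i, rfl⟩), hfb⟩
  choose f hf hfb using hex
  have := IsSimpleModule.nontrivial R M
  obtain ⟨m, hm⟩ := exists_ne (0 : M)
  have hne : ∀ c, f c (σ m) ≠ 0 := fun c => by rwa [hfb, hσ]
  -- The values `f c (y i) = -c i` recover `c`. The zero map is one homomorphism more, which makes
  -- the count strict.
  have hinj : Function.Injective (fun c : Option (ι → M) => c.elim 0 f) := by
    rintro (_ | c) (_ | c') hcc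
    · rfl
    · exact absurd (congrArg (fun g : P →ₗ[R] M => g (σ m)) hcc).symm (hne c')
    · exact absurd (congrArg (fun g : P →ₗ[R] M => g (σ m)) hcc) (hne c)
    · have hval : ∀ c i, f c (y i) = - c i := fun c i => by
        have := hf c i
        simp only [z, map_add, hfb, hσ] at this
        exact eq_neg_of_add_eq_zero_left this
      congr 1
      funext i
      have := congrArg (fun g : P →ₗ[R] M => g (y i)) hcc
      simpa [hval] using this
  obtain ⟨hfin, hcard⟩ := h (f 0) ⟨σ m, (σ m).2, hne 0⟩
  have hle := Nat.card_le_card_of_injective _ hinj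
  rw [Finite.card_option, Nat.card_fun] at hle
  omega

/-- A family that spans a module modulo a finite submodule can be lifted to a spanning family if
every simple quotient that is visible on the submodule admits few homomorphisms. -/
theorem exists_lift_span {R P ι : Type*} [Ring R] [AddCommGroup P] [Module R P] [Finite ι]
    (B : Submodule R P) [Finite B] (x : ι → P) (hx : Submodule.span R (Set.range x) ⊔ B = ⊤)
    (h : ∀ I : Ideal R, I.IsMaximal → ∀ f : P →ₗ[R] R ⧸ I, (∃ b ∈ B, f b ≠ 0) →
      Finite (P →ₗ[R] R ⧸ I) ∧ Nat.card (P →ₗ[R] R ⧸ I) ≤ Nat.card (R ⧸ I) ^ Nat.card ι) :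
    ∃ y : ι → P, (∀ i, y i - x i ∈ B) ∧ Submodule.span R (Set.range y) = ⊤ := by
  let Q : Submodule R B → Prop := fun C => ∃ y : ι → P, (∀ i, y i - x i ∈ B) ∧
    Submodule.span R (Set.range y) ⊔ C.map B.subtype = ⊤
  have : Finite (Submodule R B) := Finite.of_injective _ SetLike.coe_injective
  -- A minimal `C` modulo which some lift spans must be zero: otherwise a simple quotient of `C`
  -- allows a further descent.
  obtain ⟨C, hC⟩ := (Set.toFinite {C | Q C}).exists_minimal ⟨⊤, x, by simp, by simpa using hx⟩
  obtain ⟨y, hyB, hy⟩ := hC.prop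
  rcases eq_or_ne C ⊥ with rfl | hne
  · exact ⟨y, hyB, by simpa using hy⟩
  exfalso
  have : Nontrivial C := Submodule.nontrivial_iff_ne_bot.2 hne
  obtain ⟨D, hD⟩ := IsCoatomic.exists_coatom (Submodule R C)
  have hsimp := isSimpleModule_iff_isCoatom.2 hD
  -- The form `R ⧸ I` keeps the simple module in the universe of `R`, as `hValues` will require.
  obtain ⟨I, hI, ⟨e⟩⟩ := isSimpleModule_iff_quot_maximal.1 hsimp
  let C' := C.map B.subtype
  let eC : C ≃ₗ[R] C' := Submodule.equivMapOfInjective _ B.subtype_injective C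
  let π : C' →ₗ[R] R ⧸ I := (e.toLinearMap.comp D.mkQ).comp eC.symm.toLinearMap
  have hπ : Function.Surjective π :=
    (e.surjective.comp D.mkQ_surjective).comp eC.symm.surjective
  have : Finite C' := Finite.of_equiv _ eC.toEquiv
  have : Finite (R ⧸ I) := Finite.of_surjective _ hπ
  have : IsSimpleModule R (R ⧸ I) := IsSimpleModule.congr e.symm
  have hC'B : C' ≤ B := Submodule.map_subtype_le _ _
  obtain ⟨z, hz, hspan⟩ := exists_lift_span_sup_ker C' π hπ y hy
    fun f ⟨b, hb, hfb⟩ => h I hI f ⟨b, hC'B hb, hfb⟩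
  let D' : Submodule R B := ((LinearMap.ker π).map C'.subtype).comap B.subtype
  have hD'map : D'.map B.subtype = (LinearMap.ker π).map C'.subtype := by
    rw [Submodule.map_comap_subtype, inf_eq_right]
    exact (Submodule.map_subtype_le _ _).trans hC'B
  have hD'C : D' ≤ C := by
    intro b hb
    obtain ⟨c, -, hc⟩ := hb
    obtain ⟨c', hc', hcc⟩ := c.2
    have : c' = b := Subtype.ext (hcc.trans hc)
    exact this ▸ hc'
  have hQ : Q D' := ⟨z, fun i => by
    have := add_mem (hC'B (hz i)) (hyB i)
    rwa [sub_add_sub_cancel] at this, by rwa [hD'map]⟩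
  have hCD : C ≤ D' := hC.le_of_le hQ hD'C
  have := IsSimpleModule.nontrivial R (R ⧸ I)
  obtain ⟨m, hm⟩ := exists_ne (0 : R ⧸ I)
  obtain ⟨c, rfl⟩ := hπ m
  obtain ⟨c', hc', hcc⟩ := c.2
  obtain ⟨d, hd, hdc⟩ := hCD hc'
  have : d = c := Subtype.ext (hdc.trans hcc)
  exact hm (this ▸ hd)

/-! ### The augmentation ideal and generation of split extensions. -/

/-- The augmentation ideal of the integral group ring. -/
noncomputable abbrev augIdeal (K : Type*) [Group K] : Submodule (MonoidAlgebra ℤ K) (MonoidAlgebra ℤ K) :=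
  Submodule.span _ (Set.range fun k : K => MonoidAlgebra.of ℤ K k - 1)

/-- The generator `k - 1` of the augmentation ideal. -/
noncomputable def augIdeal.gen {K : Type*} [Group K] (k : K) : augIdeal K :=
  ⟨MonoidAlgebra.of ℤ K k - 1, Submodule.subset_span ⟨k, rfl⟩⟩

theorem augIdeal.span_range_gen (K : Type*) [Group K] :
    Submodule.span (MonoidAlgebra ℤ K) (Set.range (augIdeal.gen (K := K))) = ⊤ := by
  apply Submodule.map_injective_of_injective (augIdeal K).subtype_injective
  rw [Submodule.map_span, Submodule.map_top, Submodule.range_subtype, ← Set.range_comp]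
  rfl

theorem augIdeal.gen_mul {K : Type*} [Group K] (k l : K) :
    augIdeal.gen (k * l) = MonoidAlgebra.of ℤ K k • augIdeal.gen l + augIdeal.gen k := by
  ext1
  simp only [augIdeal.gen, Submodule.coe_add, Submodule.coe_smul, smul_eq_mul, map_mul, mul_sub,
    mul_one]
  abel

/-- A crossed homomorphism is induced by a linear map on the augmentation ideal. -/
theorem augIdeal.exists_linearMap {K V : Type*} [Group K] [AddCommGroup V]
    [Module (MonoidAlgebra ℤ K) V] (δ : K → V)
    (hδ : ∀ k l, δ (k * l) = MonoidAlgebra.of ℤ K k • δ l + δ k) :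
    ∃ F : augIdeal K →ₗ[MonoidAlgebra ℤ K] V, ∀ k, F (augIdeal.gen k) = δ k := by
  let F : MonoidAlgebra ℤ K →ₗ[ℤ] V :=
    ((Finsupp.linearCombination ℤ δ).toAddMonoidHom.comp
      MonoidAlgebra.coeffAddEquiv.toAddMonoidHom).toIntLinearMap
  have hF : ∀ k, F (MonoidAlgebra.of ℤ K k) = δ k := fun k => by simp [F]
  -- `F` is only additive on the whole group ring. On the augmentation ideal the cocycle identity
  -- gives `F (g (k - 1)) = δ (g k) - δ g = g δ k`.
  have hgen : ∀ (r : MonoidAlgebra ℤ K) (k : K),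
      F (r * (MonoidAlgebra.of ℤ K k - 1)) = r • δ k := fun r k => by
    induction r using MonoidAlgebra.induction_on with
    | of g => rw [mul_sub, mul_one, ← map_mul, map_sub, hF, hF, hδ, add_sub_cancel_right]
    | add x y hx hy => rw [add_mul, map_add, hx, hy, add_smul]
    | smul n x hx => rw [smul_mul_assoc, map_smul, hx, smul_assoc]
  have hlin : ∀ (r : MonoidAlgebra ℤ K), ∀ a ∈ augIdeal K, F (r * a) = r • F a := by
    intro r a ha
    induction ha using Submodule.span_induction generalizing r with
    | mem x hx =>
      obtain ⟨k, rfl⟩ := hx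
      have := hgen 1 k
      rw [one_mul, one_smul] at this
      rw [hgen, this]
    | zero => simp
    | add x y _ _ hx hy => rw [mul_add, map_add, hx, hy, map_add, smul_add]
    | smul s x _ hx => rw [smul_eq_mul, ← mul_assoc, hx, hx, mul_smul]
  refine ⟨{ toFun := fun a => F a, map_add' := by simp,
            map_smul' := fun r a => hlin r a a.2 }, fun k => ?_⟩
  have := hgen 1 k
  rwa [one_mul, one_smul] at this

/-- Generation of a split extension by an abelian group, in terms of modules. -/
theorem closure_range_eq_top_of_span {N K V ι : Type*} [CommGroup N] [Group K] (φ : K →* MulAut N)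
    [AddCommGroup V] [Module (MonoidAlgebra ℤ K) V] (e : Additive N ≃+ V)
    (he : ∀ k n, e (Additive.ofMul (φ k n)) = MonoidAlgebra.of ℤ K k • e (Additive.ofMul n))
    (x : ι → N) (k : ι → K) (hk : Subgroup.closure (Set.range k) = ⊤)
    (hspan : Submodule.span (MonoidAlgebra ℤ K)
      (Set.range fun i => (e (Additive.ofMul (x i)), augIdeal.gen (k i))) = ⊤) :
    Subgroup.closure (Set.range fun i => (⟨x i, k i⟩ : N ⋊[φ] K)) = ⊤ := by
  set L := Subgroup.closure (Set.range fun i => (⟨x i, k i⟩ : N ⋊[φ] K)) with hL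
  have hgen : ∀ i, (⟨x i, k i⟩ : N ⋊[φ] K) ∈ L := fun i => Subgroup.subset_closure ⟨i, rfl⟩
  have hsurj : ∀ l : K, ∃ n, (⟨n, l⟩ : N ⋊[φ] K) ∈ L := fun l => by
    have : l ∈ L.map SemidirectProduct.rightHom := by
      rw [hL, MonoidHom.map_closure, ← Set.range_comp]
      exact hk.ge trivial
    obtain ⟨g, hg, rfl⟩ := this
    exact ⟨g.left, hg⟩
  have hmem : ∀ {n n' l}, (⟨n, l⟩ : N ⋊[φ] K) ∈ L → (⟨n', l⟩ : N ⋊[φ] K) ∈ L →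
      (⟨n * n'⁻¹, 1⟩ : N ⋊[φ] K) ∈ L := fun {n n' l} h h' => by
    convert! mul_mem h (inv_mem h') using 1
    ext <;> simp
  -- `A` is `L ∩ N`. It is `K`-stable because `L` maps onto `K` and `N`, being abelian, acts
  -- trivially on itself by conjugation.
  let A : Submodule (MonoidAlgebra ℤ K) V :=
    { carrier := {v | (⟨(e.symm v).toMul, 1⟩ : N ⋊[φ] K) ∈ L}
      zero_mem' := by
        have : (⟨(e.symm 0).toMul, 1⟩ : N ⋊[φ] K) = 1 := by ext <;> simp
        exact (congrArg (· ∈ L) this).mpr (one_mem L)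
      add_mem' := fun {a b} ha hb => by
        have : (⟨(e.symm (a + b)).toMul, 1⟩ : N ⋊[φ] K) =
          ⟨(e.symm a).toMul, 1⟩ * ⟨(e.symm b).toMul, 1⟩ := by ext <;> simp
        exact (congrArg (· ∈ L) this).mpr (mul_mem ha hb)
      smul_mem' := fun r a ha => by
        induction r using MonoidAlgebra.induction_on with
        | of g =>
          obtain ⟨n, hn⟩ := hsurj g
          have h1 : e.symm (MonoidAlgebra.of ℤ K g • a) =
              Additive.ofMul (φ g (e.symm a).toMul) := by
            rw [AddEquiv.symm_apply_eq, he]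
            simp
          have : (⟨(e.symm (MonoidAlgebra.of ℤ K g • a)).toMul, 1⟩ : N ⋊[φ] K) =
              ⟨n, g⟩ * ⟨(e.symm a).toMul, 1⟩ * ⟨n, g⟩⁻¹ := by
            rw [h1]
            ext <;> simp [mul_comm]
          exact (congrArg (· ∈ L) this).mpr (mul_mem (mul_mem hn ha) (inv_mem hn))
        | add x y hx hy =>
          have : (⟨(e.symm ((x + y) • a)).toMul, 1⟩ : N ⋊[φ] K) =
            ⟨(e.symm (x • a)).toMul, 1⟩ * ⟨(e.symm (y • a)).toMul, 1⟩ := by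
              ext <;> simp [add_smul]
          exact (congrArg (· ∈ L) this).mpr (mul_mem hx hy)
        | smul z x hx =>
          have : (⟨(e.symm ((z • x) • a)).toMul, 1⟩ : N ⋊[φ] K) =
            ⟨(e.symm (x • a)).toMul, 1⟩ ^ z := by
              have h1 := map_zpow (SemidirectProduct.inl (φ := φ)) (e.symm (x • a)).toMul z
              refine Eq.trans ?_ h1
              rw [smul_assoc, map_zsmul]
              rfl
          exact (congrArg (· ∈ L) this).mpr (zpow_mem hx z) }
  have hA : ∀ n, e (Additive.ofMul n) ∈ A ↔ (⟨n, 1⟩ : N ⋊[φ] K) ∈ L := fun n => by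
    change (⟨(e.symm (e (Additive.ofMul n))).toMul, 1⟩ : N ⋊[φ] K) ∈ L ↔ _
    simp
  choose s hs using fun l => hsurj l
  -- Modulo `A`, the `N`-part of an element of `L` depends only on its image in `K`, so it defines a
  -- crossed homomorphism.
  let δ : K → V ⧸ A := fun l => A.mkQ (e (Additive.ofMul (s l)))
  have hδmem : ∀ {n l}, (⟨n, l⟩ : N ⋊[φ] K) ∈ L → A.mkQ (e (Additive.ofMul n)) = δ l :=
    fun {n l} h => by
      refine (Submodule.Quotient.eq A).2 ?_
      rw [← map_sub, ← ofMul_div, hA, div_eq_mul_inv]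
      exact hmem h (hs l)
  have hδ : ∀ l m, δ (l * m) = MonoidAlgebra.of ℤ K l • δ m + δ l := fun l m => by
    have h := hδmem (mul_mem (hs l) (hs m))
    refine Eq.trans h.symm ?_
    simp only [δ, ← map_smul, ← he, ← map_add, ← ofMul_mul]
    rw [mul_comm (φ l (s m))]
    rfl
  obtain ⟨F, hF⟩ := augIdeal.exists_linearMap δ hδ
  -- The two maps agree on the spanning pairs; evaluating at `(v, 0)` then puts every `v` in `A`.
  have hzero : A.mkQ.comp (LinearMap.fst _ V (augIdeal K)) =
      F.comp (LinearMap.snd _ V (augIdeal K)) := by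
    refine LinearMap.ext_on_range hspan fun i => ?_
    simpa [hF] using hδmem (hgen i)
  have hN : ∀ n, (⟨n, 1⟩ : N ⋊[φ] K) ∈ L := fun n => by
    have := LinearMap.congr_fun hzero (e (Additive.ofMul n), 0)
    rw [← hA, ← Submodule.Quotient.mk_eq_zero]
    simpa using this
  refine eq_top_iff.2 fun g _ => ?_
  have := mul_mem (hN (g.left * (s g.right)⁻¹)) (hs g.right)
  convert! this using 1
  ext <;> simp

/-! ### Counting homomorphisms and crossed homomorphisms. -/

theorem MonoidHom.natCard_le_pow_rank (G A : Type*) [Group G] [Group.FG G] [Group A] [Finite A] :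
    Finite (G →* A) ∧ Nat.card (G →* A) ≤ Nat.card A ^ Group.rank G := by
  obtain ⟨S, hcard, hS⟩ := Group.rank_spec G
  have hinj : Function.Injective (fun (f : G →* A) (x : S) => f x) := fun f g hfg =>
    MonoidHom.eq_of_eqOn_dense hS fun x hx => congrFun hfg ⟨x, hx⟩
  refine ⟨Finite.of_injective _ hinj, (Nat.card_le_card_of_injective _ hinj).trans_eq ?_⟩
  rw [Nat.card_fun, Nat.card_eq_finsetCard, hcard]

/-- Homomorphisms to a group of exponent `p` are determined on a Sylow `p`-subgroup. -/
theorem MonoidHom.natCard_le_pow_sylowRank (p : ℕ) [Fact p.Prime] (H A : Type*) [CommGroup H]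
    [Finite H] [CommGroup A] [Finite A] (hA : ∀ a : A, a ^ p = 1) :
    Nat.card (H →* A) ≤ Nat.card A ^ sylowRank p H := by
  let P : Sylow p H := default
  obtain ⟨_, hP⟩ := MonoidHom.natCard_le_pow_rank (P : Subgroup H) A
  refine le_trans (Nat.card_le_card_of_injective
    (fun f : H →* A => f.comp (P : Subgroup H).subtype) fun f g hfg => ?_) hP
  ext x
  have hx : x ^ (P : Subgroup H).index ∈ (P : Subgroup H) := Subgroup.pow_index_mem _ x
  have heq : f x ^ (P : Subgroup H).index = g x ^ (P : Subgroup H).index := by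
    rw [← map_pow, ← map_pow]
    exact DFunLike.congr_fun hfg ⟨_, hx⟩
  have hcop : Nat.Coprime p (P : Subgroup H).index :=
    (Nat.Prime.coprime_iff_not_dvd Fact.out).2 P.not_dvd_index
  have h1 : (f x / g x) ^ (P : Subgroup H).index = 1 := by rw [div_pow, heq, div_self']
  have h2 : f x / g x = 1 := by
    rw [← orderOf_eq_one_iff]
    exact Nat.eq_one_of_dvd_coprimes hcop (orderOf_dvd_of_pow_eq_one (hA _))
      (orderOf_dvd_of_pow_eq_one h1)
  exact div_eq_one.1 h2

/-- The coboundaries are an image of `M` under `m ↦ (g ↦ g m - m)`, so there are at most `|M|` of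
them. -/
theorem natCard_oneCocycles_le (p : ℕ) (G M : Type*) [Group G] [AddCommGroup M]
    [Module (MonoidAlgebra (ZMod p) G) M] [Finite G] [Finite M] :
    Nat.card (oneCocycles p G M) ≤ Nat.card M * Nat.card (FirstCohomology p G M) := by
  rw [Submodule.card_eq_card_quotient_mul_card
    ((oneCoboundaries p G M).submoduleOf (oneCocycles p G M))]
  refine Nat.mul_le_mul_right _ ?_
  have hcob : ∀ m : M, (fun g : G => MonoidAlgebra.of (ZMod p) G g • m - m) ∈
      oneCoboundaries p G M := fun m => ⟨m, fun _ => rfl⟩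
  refine Nat.card_le_card_of_surjective
    (fun m : M => (⟨⟨_, oneCoboundaries_le_oneCocycles p G M (hcob m)⟩, hcob m⟩ :
      (oneCoboundaries p G M).submoduleOf (oneCocycles p G M))) ?_
  rintro ⟨⟨f, hf⟩, m, hm⟩
  exact ⟨m, by ext g; exact (hm g).symm⟩

/-- The numerical meaning of `h_G(M)`. -/
theorem pow_mul_natCard_oneCocycles_le (p : ℕ) [Fact p.Prime] (G M : Type*) [Group G]
    [AddCommGroup M] [Module (MonoidAlgebra (ZMod p) G) M]
    [IsSimpleModule (MonoidAlgebra (ZMod p) G) M] [Finite G] [Finite M] (a d : ℕ)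
    (h : hInv p G M + a ≤ d) :
    Nat.card M ^ a * Nat.card (oneCocycles p G M) ≤ Nat.card M ^ d := by
  classical
  have : Finite (EndG p G M) := Finite.of_injective _ DFunLike.coe_injective
  have : Nontrivial M := IsSimpleModule.nontrivial (MonoidAlgebra (ZMod p) G) M
  have hq : 1 ≤ Nat.card (EndG p G M) := Nat.card_pos
  have hM : Nat.card M = Nat.card (EndG p G M) ^ rInv p G M :=
    Module.natCard_eq_pow_finrank (K := EndG p G M) (V := M)
  have hH : Nat.card (FirstCohomology p G M) = Nat.card (EndG p G M) ^ sInv p G M :=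
    Module.natCard_eq_pow_finrank (K := EndG p G M) (V := FirstCohomology p G M)
  have hr : 0 < rInv p G M := Module.finrank_pos
  refine (Nat.mul_le_mul_left _ (natCard_oneCocycles_le p G M)).trans ?_
  rw [hH, hM, ← pow_add, ← pow_mul, ← pow_mul, ← pow_add]
  refine Nat.pow_le_pow_right hq ?_
  unfold hInv at h
  generalize rInv p G M = r at *
  generalize sInv p G M = s at *
  -- With `q = |End_G(M)|`, the exponents of `q` must satisfy `r a + r + s ≤ r d`. From `s - 1 <
  -- (⌊(s - 1) / r⌋ + 1) r` follows `s + r ≤ h r`, also for `s = 0`, where the floor is `-1`.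
  have h1 := Int.lt_ediv_add_one_mul_self ((s : ℤ) - 1) (by exact_mod_cast hr : (0 : ℤ) < r)
  have h2 : ((s : ℤ) - 1) / r + 2 ≤ d - a := by omega
  zify
  nlinarith

/-- Homomorphisms from `V × augIdeal K` amount to homomorphisms on `V` and crossed
homomorphisms. -/
theorem natCard_linearMap_prod_augIdeal_le {K H V M : Type*} [Group K] [Finite K] [Group H]
    [Finite H] [AddCommGroup V] [Module (MonoidAlgebra ℤ K) V] [AddCommGroup M] [Finite M]
    [Module (MonoidAlgebra ℤ K) M] (j : H →* Multiplicative V)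
    (hj : Submodule.span (MonoidAlgebra ℤ K) (Set.range fun h => (j h).toAdd) = ⊤) :
    Finite (V × augIdeal K →ₗ[MonoidAlgebra ℤ K] M) ∧
      Nat.card (V × augIdeal K →ₗ[MonoidAlgebra ℤ K] M) ≤ Nat.card (H →* Multiplicative M) *
        Nat.card {δ : K → M // ∀ k l, δ (k * l) = MonoidAlgebra.of ℤ K k • δ l + δ k} := by
  have : Finite (H →* Multiplicative M) := Finite.of_injective _ DFunLike.coe_injective
  let Φ : (V × augIdeal K →ₗ[MonoidAlgebra ℤ K] M) → (H →* Multiplicative M) ×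
      {δ : K → M // ∀ k l, δ (k * l) = MonoidAlgebra.of ℤ K k • δ l + δ k} := fun f =>
    ((f.comp (LinearMap.inl _ _ _)).toAddMonoidHom.toMultiplicative.comp j,
      ⟨fun k => f (0, augIdeal.gen k), fun k l => by
        beta_reduce
        rw [augIdeal.gen_mul, ← map_smul, ← map_add]
        simp⟩)
  have hΦ : Function.Injective Φ := fun f g hfg => by
    obtain ⟨h1, h2⟩ := Prod.ext_iff.1 hfg
    refine LinearMap.prod_ext (LinearMap.ext_on_range hj fun h => ?_)
      (LinearMap.ext_on_range (augIdeal.span_range_gen K) fun k => ?_)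
    · exact DFunLike.congr_fun h1 h
    · exact congrFun (congrArg Subtype.val h2) k
  refine ⟨Finite.of_injective Φ hΦ, (Nat.card_le_card_of_injective Φ hΦ).trans_eq ?_⟩
  rw [Nat.card_prod]

/-- A simple integral representation of exponent `p` is one over the field with `p` elements. -/
theorem exists_module_zmod {K M : Type*} [Group K] [AddCommGroup M] [Module (MonoidAlgebra ℤ K) M]
    [IsSimpleModule (MonoidAlgebra ℤ K) M] (p : ℕ) (hp : ∀ m : M, p • m = 0) :
    ∃ _ : Module (MonoidAlgebra (ZMod p) K) M,
      IsSimpleModule (MonoidAlgebra (ZMod p) K) M ∧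
      ∀ (k : K) (m : M), MonoidAlgebra.of (ZMod p) K k • m = MonoidAlgebra.of ℤ K k • m := by
  obtain ⟨_⟩ : Nonempty (Module (ZMod p) M) := ⟨AddCommGroup.zmodModule hp⟩
  let act : K → Module.End (ZMod p) M := fun k =>
    { toFun := fun m => MonoidAlgebra.of ℤ K k • m
      map_add' := smul_add _
      map_smul' := ZMod.map_smul (DistribSMul.toAddMonoidHom M (MonoidAlgebra.of ℤ K k)) }
  have hact : ∀ (k : K) (m : M), act k m = MonoidAlgebra.of ℤ K k • m := fun _ _ => rfl
  let ρ : K →* Module.End (ZMod p) M :=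
    { toFun := act
      map_one' := LinearMap.ext fun m => by
        rw [hact, map_one, one_smul, Module.End.one_apply]
      map_mul' := fun k l => LinearMap.ext fun m => by
        rw [Module.End.mul_apply, hact, hact, hact, map_mul, mul_smul] }
  let inst : Module (MonoidAlgebra (ZMod p) K) M :=
    Module.compHom M (MonoidAlgebra.lift (ZMod p) (Module.End (ZMod p) M) K ρ).toRingHom
  have hof : ∀ (k : K) (m : M),
      MonoidAlgebra.of (ZMod p) K k • m = MonoidAlgebra.of ℤ K k • m := fun k m => by
    change MonoidAlgebra.lift (ZMod p) (Module.End (ZMod p) M) K ρ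
      (MonoidAlgebra.of (ZMod p) K k) m = _
    rw [MonoidAlgebra.lift_of]
    rfl
  refine ⟨inst, ?_, hof⟩
  let σ : MonoidAlgebra ℤ K →+* MonoidAlgebra (ZMod p) K :=
    MonoidAlgebra.mapRingHom K (Int.castRingHom (ZMod p))
  have hσof : ∀ k, σ (MonoidAlgebra.of ℤ K k) = MonoidAlgebra.of (ZMod p) K k := fun k => by
    simp [σ]
  have hσ : ∀ (r : MonoidAlgebra ℤ K) (m : M), σ r • m = r • m := fun r m => by
    induction r using MonoidAlgebra.induction_on with
    | of k => rw [hσof, hof]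
    | add x y hx hy => rw [map_add, add_smul, add_smul, hx, hy]
    | smul z x hx => rw [map_zsmul, smul_assoc, smul_assoc, hx]
  have : RingHomSurjective σ := ⟨fun y => by
    induction y using MonoidAlgebra.induction_on with
    | of k => exact ⟨_, hσof k⟩
    | add x y hx hy =>
      obtain ⟨⟨a, rfl⟩, ⟨b, rfl⟩⟩ := hx, hy
      exact ⟨a + b, map_add _ _ _⟩
    | smul z x hx =>
      obtain ⟨a, rfl⟩ := hx
      obtain ⟨n, rfl⟩ := ZMod.intCast_surjective z
      exact ⟨n • a, by rw [map_zsmul, Int.cast_smul_eq_zsmul]⟩⟩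
  let l : M →ₛₗ[σ] M :=
    { toFun := id, map_add' := fun _ _ => rfl, map_smul' := fun r m => (hσ r m).symm }
  exact (LinearMap.isSimpleModule_iff_of_bijective l Function.bijective_id).1 inferInstance

/-! ### Bounds for the simple modules. -/

/-- A simple module receiving a nonzero element of finite order `n` has exponent a prime divisor
of `n`. -/
theorem IsSimpleModule.exists_prime_nsmul_eq_zero {R M : Type*} [Ring R] [AddCommGroup M]
    [Module R M] [IsSimpleModule R M] {m : M} (hm : m ≠ 0) {n : ℕ} (hn : n ≠ 0) (h : n • m = 0) :
    ∃ p ∈ n.primeFactors, ∀ x : M, p • x = 0 := by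
  have hdvd : addOrderOf m ∣ n := addOrderOf_dvd_of_nsmul_eq_zero h
  have h1 : addOrderOf m ≠ 1 := fun h1 => hm (AddMonoid.addOrderOf_eq_one_iff.1 h1)
  obtain ⟨p, hp, c, hc⟩ := Nat.exists_prime_and_dvd h1
  refine ⟨p, Nat.mem_primeFactors.2 ⟨hp, (Dvd.intro _ hc.symm).trans hdvd, hn⟩, ?_⟩
  -- Multiplication by `p` is an endomorphism killing `c • m ≠ 0`; by simplicity its kernel is
  -- everything.
  let f : Module.End R M := p • LinearMap.id
  have hcm : c • m ≠ 0 := fun h0 => by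
    have h2 := Nat.le_of_dvd (Nat.pos_of_ne_zero ?_) (addOrderOf_dvd_of_nsmul_eq_zero h0)
    · have : c ≠ 0 := by
        rintro rfl
        exact hn (Nat.eq_zero_of_zero_dvd (by simpa [hc] using hdvd))
      nlinarith [hp.two_le, Nat.pos_of_ne_zero this]
    · rintro rfl
      exact hn (Nat.eq_zero_of_zero_dvd (by simpa [hc] using hdvd))
  have hker : c • m ∈ LinearMap.ker f := by
    change p • c • m = 0
    rw [← mul_nsmul', ← hc, addOrderOf_nsmul_eq_zero]
  rcases eq_bot_or_eq_top (LinearMap.ker f) with hb | ht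
  · exact absurd ((Submodule.mem_bot R).1 (hb ▸ hker)) hcm
  · exact fun x => (ht ▸ Submodule.mem_top : x ∈ LinearMap.ker f)

/-- The bound for a trivial simple module. -/
theorem natCard_monoidHom_mul_crossedHom_le_of_trivial {K H M : Type*} [Group K] [Finite K]
    [CommGroup H] [Finite H] [AddCommGroup M] [Finite M] [Module (MonoidAlgebra ℤ K) M]
    (hM : ∀ (k : K) (m : M), MonoidAlgebra.of ℤ K k • m = m) :
    Nat.card (H →* Multiplicative M) *
        Nat.card {δ : K → M // ∀ k l, δ (k * l) = MonoidAlgebra.of ℤ K k • δ l + δ k} ≤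
      Nat.card M ^ Group.rank (H × K) := by
  obtain ⟨hfin, hcard⟩ := MonoidHom.natCard_le_pow_rank (H × K) (Multiplicative M)
  refine le_trans ?_ hcard
  rw [← Nat.card_prod]
  let toHom : {δ : K → M // ∀ k l, δ (k * l) = MonoidAlgebra.of ℤ K k • δ l + δ k} →
      (K →* Multiplicative M) := fun δ =>
    MonoidHom.mk' (fun k => Multiplicative.ofAdd (δ.1 k)) fun k l => by
      rw [δ.2, hM, add_comm]
      rfl
  refine Nat.card_le_card_of_injective (fun q => q.1.coprod (toHom q.2)) fun q q' h => ?_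
  refine Prod.ext (MonoidHom.ext fun x => ?_) (Subtype.ext (funext fun k => ?_))
  · simpa using DFunLike.congr_fun h (x, 1)
  · have := DFunLike.congr_fun h (1, k)
    simp only [MonoidHom.coprod_apply, map_one, one_mul] at this
    exact Multiplicative.ofAdd.injective this

/-- Boundedness is essential here: the `sSup` of an unbounded set in `ℕ` is the default `0`. -/
theorem add_sylowRank_le_rho {p : ℕ} [Fact p.Prime] {K : Type*} [Group K] [Finite K]
    (H : Type*) [CommGroup H] [Finite H] {x : ℕ} (hx : x ∈ hValues p K) :
    x + sylowRank p H ≤ rho K H p := by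
  refine le_csSup ?_ ⟨x, hx, rfl⟩
  obtain ⟨b, hb⟩ := bddAbove_hValues p K
  refine ⟨b + sylowRank p H, ?_⟩
  rintro _ ⟨y, hy, rfl⟩
  exact Nat.add_le_add_right (hb hy) _

/-- The bound for the simple modules that are visible on the base group. -/
theorem natCard_linearMap_le_pow.{u} {K M : Type u} {H V : Type*} [Group K] [Finite K]
    [CommGroup H] [Finite H] [AddCommGroup V] [Finite V] [Module (MonoidAlgebra ℤ K) V]
    [AddCommGroup M] [Module (MonoidAlgebra ℤ K) M] [IsSimpleModule (MonoidAlgebra ℤ K) M]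
    (j : H →* Multiplicative V)
    (hj : Submodule.span (MonoidAlgebra ℤ K) (Set.range fun h => (j h).toAdd) = ⊤) {d : ℕ}
    (hd : max (Group.rank (H × K)) ((Nat.card H).primeFactors.sup fun p => rho K H p) ≤ d)
    {g : V →ₗ[MonoidAlgebra ℤ K] M} (hg : g ≠ 0) :
    Finite (V × augIdeal K →ₗ[MonoidAlgebra ℤ K] M) ∧
      Nat.card (V × augIdeal K →ₗ[MonoidAlgebra ℤ K] M) ≤ Nat.card M ^ d := by
  have : Finite M := Finite.of_surjective g (LinearMap.surjective_of_ne_zero hg)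
  obtain ⟨hfin, hcard⟩ := natCard_linearMap_prod_augIdeal_le (M := M) j hj
  refine ⟨hfin, hcard.trans ?_⟩
  by_cases htriv : ∀ (k : K) (m : M), MonoidAlgebra.of ℤ K k • m = m
  · exact (natCard_monoidHom_mul_crossedHom_le_of_trivial htriv).trans
      (Nat.pow_le_pow_right Nat.card_pos ((le_max_left _ _).trans hd))
  -- The image of `H` spans `V`, so `g` is nonzero on it; this gives a nonzero element of `M` killed
  -- by `|H|`, and so the prime `p ∣ |H|`.
  obtain ⟨x, hx⟩ : ∃ x, g (j x).toAdd ≠ 0 := by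
    by_contra! hcon
    exact hg (LinearMap.ext_on_range hj hcon)
  have hx0 : Nat.card H • g (j x).toAdd = 0 := by
    rw [← map_nsmul, ← toAdd_pow, ← map_pow, pow_card_eq_one', map_one, toAdd_one, map_zero]
  obtain ⟨p, hp, hpM⟩ := IsSimpleModule.exists_prime_nsmul_eq_zero
    (R := MonoidAlgebra ℤ K) hx Nat.card_pos.ne' hx0
  have : Fact p.Prime := ⟨Nat.prime_of_mem_primeFactors hp⟩
  obtain ⟨inst, hsimple, hcomp⟩ := exists_module_zmod (K := K) p hpM
  have hle : hInv p K M + sylowRank p H ≤ d := by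
    have hmem : hInv p K M ∈ hValues p K := ⟨M, inferInstance, inst, hsimple,
      fun ht => htriv fun k m => (hcomp k m).symm.trans (ht k m), rfl⟩
    have hsup := Finset.le_sup (f := fun p => rho K H p) hp
    exact (add_sylowRank_le_rho H hmem).trans (hsup.trans ((le_max_right _ _).trans hd))
  refine le_trans (Nat.mul_le_mul ?_ ?_) (pow_mul_natCard_oneCocycles_le p K M _ d hle)
  · exact MonoidHom.natCard_le_pow_sylowRank p H (Multiplicative M) fun a => hpM a.toAdd
  · refine Nat.card_le_card_of_injective (fun δ =>
      (⟨δ.1, fun k l => by rw [hcomp]; exact δ.2 k l⟩ : oneCocycles p K M)) fun δ δ' h => ?_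
    exact Subtype.ext (Subtype.ext_iff.1 h :)

/-! ### Split extensions and the wreath product. -/

/-- A bound for the number of generators of a split extension whose kernel is generated, as a
module, by the image of a finite abelian group `H`. -/
theorem rank_semidirectProduct_le {K N H : Type*} [Group K] [Finite K] [CommGroup N] [Finite N]
    [CommGroup H] [Finite H] (φ : K →* MulAut N) (j : H →* N)
    (hj : ∀ S : Subgroup N, j.range ≤ S → (∀ k, ∀ n ∈ S, φ k n ∈ S) → S = ⊤)
    [Finite (N ⋊[φ] K)] :
    Group.rank (N ⋊[φ] K) ≤
      max (Group.rank (H × K)) ((Nat.card H).primeFactors.sup fun p => rho K H p) := by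
  set d := max (Group.rank (H × K)) ((Nat.card H).primeFactors.sup fun p => rho K H p) with hd
  let ρ : Representation ℤ K (Additive N) :=
    { toFun := fun k => (MonoidHom.toAdditive (φ k).toMonoidHom).toIntLinearMap
      map_one' := by ext n; simp
      map_mul' := fun k l => by ext n; simp }
  let V := ρ.asModule
  let e : Additive N ≃+ V := ρ.asModuleEquiv.symm.toAddEquiv
  have he : ∀ k n, e (Additive.ofMul (φ k n)) =
      MonoidAlgebra.of ℤ K k • e (Additive.ofMul n) := fun k n =>
    ρ.asModuleEquiv_symm_map_rho k (Additive.ofMul n)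
  let j' : H →* Multiplicative V := (AddMonoidHom.toMultiplicative e.toAddMonoidHom).comp
    (MonoidHom.mk' (fun h => Multiplicative.ofAdd (Additive.ofMul (j h))) (by intros; simp))
  have hspan : Submodule.span (MonoidAlgebra ℤ K) (Set.range fun h => (j' h).toAdd) = ⊤ := by
    set W := Submodule.span (MonoidAlgebra ℤ K) (Set.range fun h => (j' h).toAdd)
    let S : Subgroup N := 
      { carrier := {n | e (Additive.ofMul n) ∈ W}
        one_mem' := by simp
        mul_mem' := fun ha hb => by
          rw [Set.mem_ofPred_eq, ofMul_mul, map_add]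
          exact W.add_mem ha hb
        inv_mem' := fun ha => by
          rw [Set.mem_ofPred_eq, ofMul_inv, map_neg]
          exact W.neg_mem ha }
    have hS : ∀ n, n ∈ S ↔ e (Additive.ofMul n) ∈ W := fun n => Iff.rfl
    have hT := hj S (by
      rintro _ ⟨h, rfl⟩
      exact (hS _).2 (Submodule.subset_span ⟨h, rfl⟩)) fun k n hn => by
        rw [hS, he]
        exact W.smul_mem _ hn
    refine eq_top_iff.2 fun v _ => ?_
    have := (hS (e.symm v).toMul).1 (hT ▸ Subgroup.mem_top _)
    simpa using this
  have : Finite V := Finite.of_equiv _ e.toEquiv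
  have hKd : Group.rank K ≤ d :=
    (Group.rank_le_of_surjective (MonoidHom.snd H K) Prod.snd_surjective).trans (le_max_left _ _)
  -- A minimal generating set of `K`, padded with `1` to length `d`.
  obtain ⟨k, hk⟩ : ∃ k : Fin d → K, Subgroup.closure (Set.range k) = ⊤ := by
    obtain ⟨S, hcard, hS⟩ := Group.rank_spec K
    let f : Fin d → K := fun i => if h : i.1 < S.card then (S.equivFin.symm ⟨i, h⟩ : K) else 1
    refine ⟨f, eq_top_iff.2 (hS ▸ Subgroup.closure_mono fun x hx => ?_)⟩
    let i := S.equivFin ⟨x, hx⟩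
    exact ⟨⟨i, i.2.trans_le (hcard.trans_le hKd)⟩, by simp [f, i]⟩
  let B : Submodule (MonoidAlgebra ℤ K) (V × augIdeal K) :=
    LinearMap.range (LinearMap.inl (MonoidAlgebra ℤ K) V (augIdeal K))
  have : Finite B := Finite.of_surjective _ (LinearMap.surjective_rangeRestrict _)
  have haug : Submodule.span (MonoidAlgebra ℤ K) (Set.range fun i => augIdeal.gen (k i)) = ⊤ := by
    rw [eq_top_iff, ← augIdeal.span_range_gen K, Submodule.span_le]
    rintro _ ⟨l, rfl⟩
    set W := Submodule.span (MonoidAlgebra ℤ K) (Set.range fun i => augIdeal.gen (k i))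
    have hl : l ∈ Subgroup.closure (Set.range k) := hk ▸ Subgroup.mem_top l
    have h1 : augIdeal.gen (1 : K) = 0 := by
      ext1
      change MonoidAlgebra.of ℤ K 1 - 1 = 0
      rw [map_one, sub_self]
    induction hl using Subgroup.closure_induction with
    | mem x hx =>
      obtain ⟨i, rfl⟩ := hx
      exact Submodule.subset_span ⟨i, rfl⟩
    | one => rw [h1]; exact W.zero_mem
    | mul x y _ _ hx hy => rw [augIdeal.gen_mul]; exact W.add_mem (W.smul_mem _ hy) hx
    | inv x _ hx =>
      have h2 := augIdeal.gen_mul x⁻¹ x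
      rw [inv_mul_cancel, h1] at h2
      rw [eq_neg_of_add_eq_zero_right h2.symm]
      exact W.neg_mem (W.smul_mem _ hx)
  obtain ⟨y, hyB, hy⟩ := exists_lift_span B (fun i => ((0 : V), augIdeal.gen (k i))) (by
      rw [eq_top_iff]
      rintro ⟨v, a⟩ -
      have ha : ((0 : V), a) ∈ Submodule.span (MonoidAlgebra ℤ K)
          (Set.range fun i => ((0 : V), augIdeal.gen (k i))) := by
        have := Submodule.mem_map_of_mem (f := LinearMap.inr (MonoidAlgebra ℤ K) V (augIdeal K))
          (haug ▸ Submodule.mem_top : a ∈ _)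
        rwa [Submodule.map_span, ← Set.range_comp] at this
      have : (v, a) = ((0 : V), a) + (v, 0) := by simp
      rw [this]
      exact Submodule.add_mem_sup ha ⟨v, rfl⟩) (by
    rintro I hI f ⟨_, ⟨v, rfl⟩, hfv⟩
    have : IsSimpleModule (MonoidAlgebra ℤ K) (MonoidAlgebra ℤ K ⧸ I) :=
      isSimpleModule_iff_quot_maximal.2 ⟨I, hI, ⟨LinearEquiv.refl _ _⟩⟩
    rw [Nat.card_fin]
    exact natCard_linearMap_le_pow j' hspan hd.ge (g := f.comp (LinearMap.inl _ _ _))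
      fun h0 => hfv (LinearMap.congr_fun h0 v))
  -- The lift changes only the `V`-coordinate, so the second one still comes from `k i`.
  have hyk : ∀ i, y i = (e (Additive.ofMul (e.symm (y i).1).toMul), augIdeal.gen (k i)) :=
    fun i => by
      obtain ⟨v, hv⟩ := hyB i
      refine Prod.ext (by simp) ?_
      have := congrArg Prod.snd hv
      exact (sub_eq_zero.1 this.symm)
  have hgen := closure_range_eq_top_of_span φ e he (fun i => (e.symm (y i).1).toMul) k hk (by
    rw [← hy]
    congr 2
    exact (funext hyk).symm)
  classical
  let T : Finset (N ⋊[φ] K) :=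
    Finset.univ.image fun i => ⟨(e.symm (y i).1).toMul, k i⟩
  refine (Group.rank_le (S := T)
    (by rw [Finset.coe_image, Finset.coe_univ, Set.image_univ, hgen])).trans ?_
  exact Finset.card_image_le.trans_eq (by simp)

theorem mainTheorem6 {Ω : Type*} [Finite Ω] [Nonempty Ω] (K : Subgroup (Equiv.Perm Ω))
    [MulAction.IsPretransitive K Ω] (H : Type*) [CommGroup H] [Finite H] :
    Group.rank (PermWreath H K) ≤
      max (Group.rank (H × K)) ((Nat.card H).primeFactors.sup fun p => rho K H p) := by
  classical
  obtain ⟨_⟩ := nonempty_fintype Ω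
  obtain ⟨a⟩ := ‹Nonempty Ω›
  refine rank_semidirectProduct_le (mulAutArrow : K →* MulAut (Ω → H)) (MonoidHom.mulSingle (fun _ : Ω => H) a)
    fun S hS hK => eq_top_iff.2 fun f _ => ?_
  -- By transitivity the translates of the coordinate subgroup at `a` are all the coordinate
  -- subgroups, and these generate the base group.
  have hsingle : ∀ (b : Ω) (h : H), Pi.mulSingle b h ∈ S := fun b h => by
    obtain ⟨k, rfl⟩ := MulAction.exists_smul_eq K a b
    have := hK k _ (hS ⟨h, rfl⟩)
    convert! this using 1
    funext c
    change _ = (Pi.mulSingle a h : Ω → H) (k⁻¹ • c)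
    by_cases hc : c = k • a
    · subst hc
      simp
    · have hc' : k⁻¹ • c ≠ a := fun h => hc (by rw [← h, smul_inv_smul])
      simp [hc, hc']
  rw [← Finset.univ_prod_mulSingle f]
  exact Subgroup.prod_mem _ fun b _ => hsingle b (f b)
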